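/- Let $\mathcal X,\mathcal Y$ be finite nonempty alphabets and let $W(y|x)$ be the transition law of a discrete memoryless channel from $\mathcal X$ to $\mathcal Y$. For $R\ge 0$ and $n\ge 1$, a blocklength-$n$ rate-$R$ feedback encoder has message set $\{1,\dots,M_n\}$ with $M_n=\lfloor e^{nR}\rfloor$ and consists of functions $$f^{(i)}\colon\{1,\dots,M_n\}\times\mathcal Y^{i-1}\to\mathcal X,\qquad i=1,\dots,n.$$ For $\mathbf y=(y_1,\dots,y_n)\in\mathcal Y^n$, write $y^{i-1}=(y_1,\dots,y_{i-1})$, and let $$W_f(\mathbf y|m)=\prod_{i=1}^n W\bigl(y_i\big|f^{(i)}(m,y^{i-1})\bigr)$$ and $$\mathcal L(m,\mathbf y)=\{\tilde m: W_f(\mathbf y|\tilde m)\ge W_f(\mathbf y|m)\}.$$ For $\rho>0$, the cutoff rate with feedback $R_{\mathrm{cutoff,f}}(\rho)$ is the supremum of all rates $R\ge 0$ for which there is a sequence $(f_n)_{n\ge1}$ of blocklength-$n$ rate-$R$ feedback encoders with $$\lim_{n\to\infty}\frac1{M_n}\sum_{m=1}^{M_n}\sum_{\mathbf y\in\mathcal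 Y^n}W_{f_n}(\mathbf y|m)\,|\mathcal L(m,\mathbf y)|^\rho=1 .$$ For a probability mass function $P$ on $\mathcal X$, let $$E_0(\rho,P)=-\log\sum_{y\in\mathcal Y}\Bigl(\sum_{x\in\mathcal X}P(x)\,W(y|x)^{\frac1{1+\rho}}\Bigr)^{1+\rho}.$$ Theorem. For every $\rho>0$, $$R_{\mathrm{cutoff,f}}(\rho)=\max_P\frac{E_0(\rho,P)}{\rho},$$ where the maximum is over all probability mass functions $P$ on $\mathcal X$. In particular, the supremum is finite and the maximum is attained. -/

import Mathlib

open Filter Topology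

noncomputable section

/-- A discrete memoryless channel: `W.prob x y` is the transition probability `W(y|x)`. -/
structure DMC (X Y : Type*) [Fintype Y] where
  prob : X → Y → ℝ
  prob_nonneg : ∀ x y, 0 ≤ prob x y
  prob_sum : ∀ x, ∑ y, prob x y = 1

/-- Gallager's function `E₀(ρ, P)` (natural logarithm). -/
def gallagerE0 {X Y : Type*} [Fintype X] [Fintype Y] (W : DMC X Y) (ρ : ℝ) (P : X → ℝ) : ℝ :=
  -Real.log (∑ y, (∑ x, P x * W.prob x y ^ (1 / (1 + ρ))) ^ (1 + ρ))

/-- A blocklength-`n` feedback encoder for `M` messages: at time `i` (counted from `0`) the input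
symbol is a function of the message and of the `i` previous channel outputs. -/
def FeedbackEncoder (X Y : Type*) (M n : ℕ) : Type _ :=
  (i : Fin n) → Fin M → (Fin i → Y) → X

/-- The first `i` coordinates of an output sequence of length `n`. -/
def outputPrefix {Y : Type*} {n : ℕ} (y : Fin n → Y) (i : Fin n) : Fin i → Y :=
  fun j => y (Fin.castLE i.isLt.le j)

/-- The probability of the output sequence `y` when message `m` is sent with feedback. -/
def feedbackLikelihood {X Y : Type*} [Fintype Y] (W : DMC X Y) {M n : ℕ}
    (f : FeedbackEncoder X Y M n) (m : Fin M) (y : Fin n → Y) : ℝ :=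
  ∏ i : Fin n, W.prob (f i m (outputPrefix y i)) (y i)

/-- The list of all messages that are at least as likely as `m` given the output `y`. -/
def likelyList {X Y : Type*} [Fintype Y] (W : DMC X Y) {M n : ℕ}
    (f : FeedbackEncoder X Y M n) (m : Fin M) (y : Fin n → Y) : Finset (Fin M) :=
  Finset.univ.filter fun m' => feedbackLikelihood W f m y ≤ feedbackLikelihood W f m' y

/-- The `ρ`-th moment of the length of the list `likelyList`, for uniformly distributed
messages. -/
def listMoment {X Y : Type*} [Fintype Y] (W : DMC X Y) (ρ : ℝ) {M n : ℕ}
    (f : FeedbackEncoder X Y M n) : ℝ :=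
  (M : ℝ)⁻¹ * ∑ m : Fin M, ∑ y : Fin n → Y,
    feedbackLikelihood W f m y * ((likelyList W f m y).card : ℝ) ^ ρ

/-- The number of messages `⌊e^{nR}⌋` of a blocklength-`n` rate-`R` encoder. -/
def messageCount (R : ℝ) (n : ℕ) : ℕ := ⌊Real.exp (n * R)⌋₊

/-- The rates `R ≥ 0` for which some sequence of blocklength-`n` rate-`R` feedback encoders makes
the `ρ`-th moment of the list length tend to one. -/
def feedbackCutoffRates {X Y : Type*} [Fintype Y] (W : DMC X Y) (ρ : ℝ) : Set ℝ :=
  {R | 0 ≤ R ∧ ∃ f : (n : ℕ) → FeedbackEncoder X Y (messageCount R n) n,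
    Tendsto (fun n => listMoment W ρ (f n)) atTop (𝓝 1)}

/-- The cutoff rate with feedback. -/
def feedbackCutoffRate {X Y : Type*} [Fintype Y] (W : DMC X Y) (ρ : ℝ) : ℝ :=
  sSup (feedbackCutoffRates W ρ)

end

/-! Everything turns on the minimum `g` of Gallager's sum over the simplex, because the maximum of
`E₀/ρ` is `-log g / ρ`.

Converse: the list length is the likelihood rank of the true message, ties counted against it, and
reciprocal ranks sum to at most `1 + log M`. Hölder therefore bounds the Gallager sum over messages
by the rank moment times a logarithmic factor (`rpow_mul_pow_le_listMoment`). Feedback cannot push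
that Gallager sum below `g ^ n` times its initial value: given the past outputs, the past
likelihoods are mere weights on the messages, so each channel use costs at least a factor `g`
(`rpow_sum_mul_pow_le_sum_feedback`). Above the critical rate the moment then grows exponentially.

Achievability needs no feedback. With independent random codewords, the number of competitors given
the sent word and the output is binomial, so its `ρ`-th moment is controlled by its mean, and the
excess of the list moment over one vanishes below the critical rate (`exists_codebook_le`). -/

/-- The sum `∑ y, (∑ x, P x * W(y|x) ^ (1 / (1 + ρ))) ^ (1 + ρ)` inside the logarithm of
Gallager's function. -/
noncomputable def gallagerSum {X Y : Type*} [Fintype X] [Fintype Y] (W : DMC X Y) (ρ : ℝ)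
    (P : X → ℝ) : ℝ :=
  ∑ y, (∑ x, P x * W.prob x y ^ (1 / (1 + ρ))) ^ (1 + ρ)

/-! ### Single-letter properties of Gallager's sum. -/

section GallagerSum

variable {X Y : Type*} [Fintype X] [Fintype Y] (W : DMC X Y) {ρ : ℝ} {P : X → ℝ}

theorem gallagerE0_eq_neg_log (ρ : ℝ) (P : X → ℝ) :
    gallagerE0 W ρ P = -Real.log (gallagerSum W ρ P) := rfl

theorem gallagerInner_nonneg (hP : ∀ x, 0 ≤ P x) (y : Y) :
    0 ≤ ∑ x, P x * W.prob x y ^ (1 / (1 + ρ)) :=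
  Finset.sum_nonneg fun x _ => mul_nonneg (hP x) (Real.rpow_nonneg (W.prob_nonneg x y) _)

theorem gallagerSum_pos (hP : P ∈ stdSimplex ℝ X) : 0 < gallagerSum W ρ P := by
  obtain ⟨x, hx⟩ : ∃ x, 0 < P x := by
    by_contra! h
    have h1 := hP.2
    have h2 : ∑ x, P x ≤ 0 := Finset.sum_nonpos fun x _ => h x
    linarith
  obtain ⟨y, hy⟩ : ∃ y, 0 < W.prob x y := by
    by_contra! h
    have h1 := W.prob_sum x
    have h2 : ∑ y, W.prob x y ≤ 0 := Finset.sum_nonpos fun y _ => h y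
    linarith
  refine Finset.sum_pos' (fun y _ => Real.rpow_nonneg (gallagerInner_nonneg W hP.1 y) _)
    ⟨y, Finset.mem_univ y, Real.rpow_pos_of_pos ?_ _⟩
  exact Finset.sum_pos' (fun x _ => mul_nonneg (hP.1 x) (Real.rpow_nonneg (W.prob_nonneg x y) _))
    ⟨x, Finset.mem_univ x, mul_pos hx (Real.rpow_pos_of_pos hy _)⟩

theorem gallagerSum_le_one (hρ : 0 < ρ) (hP : P ∈ stdSimplex ℝ X) : gallagerSum W ρ P ≤ 1 := by
  have h1 : (1 : ℝ) + ρ ≠ 0 := by positivity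
  calc gallagerSum W ρ P
      ≤ ∑ y, ∑ x, P x * (W.prob x y ^ (1 / (1 + ρ))) ^ (1 + ρ) :=
        Finset.sum_le_sum fun y _ => Real.rpow_arith_mean_le_arith_mean_rpow _ _ _
          (fun x _ => hP.1 x) hP.2 (fun x _ => Real.rpow_nonneg (W.prob_nonneg x y) _)
          (by linarith)
    _ = ∑ y, ∑ x, P x * W.prob x y := by
        refine Finset.sum_congr rfl fun y _ => Finset.sum_congr rfl fun x _ => ?_
        rw [← Real.rpow_mul (W.prob_nonneg x y), one_div_mul_cancel h1, Real.rpow_one]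
    _ = 1 := by
        rw [Finset.sum_comm]
        simp_rw [← Finset.mul_sum, W.prob_sum, mul_one]
        exact hP.2

theorem continuous_gallagerSum (hρ : 0 < ρ) : Continuous (gallagerSum W ρ) := by
  unfold gallagerSum
  refine continuous_finsetSum _ fun y _ => Continuous.rpow_const ?_ fun _ => Or.inr (by linarith)
  fun_prop

/-- Compactness of the simplex. The minimizer is the optimal input law, and its value is the
constant `g` of the converse. -/
theorem exists_forall_gallagerSum_le [Nonempty X] (hρ : 0 < ρ) :
    ∃ P ∈ stdSimplex ℝ X, ∀ Q ∈ stdSimplex ℝ X, gallagerSum W ρ P ≤ gallagerSum W ρ Q := by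
  classical
  obtain ⟨x⟩ := ‹Nonempty X›
  obtain ⟨P, hP, h⟩ := (isCompact_stdSimplex ℝ X).exists_isMinOn
    ⟨Pi.single x 1, single_mem_stdSimplex ℝ x⟩ (continuous_gallagerSum W hρ).continuousOn
  exact ⟨P, hP, fun Q hQ => h hQ⟩

/-- The homogeneous form of a lower bound for `gallagerSum`, with weights indexed by messages. -/
theorem rpow_sum_mul_le_sum_rpow {ι : Type*} [Fintype ι] (hρ : 0 < ρ) {g : ℝ}
    (hg : ∀ Q ∈ stdSimplex ℝ X, g ≤ gallagerSum W ρ Q) (a : ι → ℝ) (ha : ∀ i, 0 ≤ a i)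
    (φ : ι → X) :
    (∑ i, a i) ^ (1 + ρ) * g ≤ ∑ y, (∑ i, a i * W.prob (φ i) y ^ (1 / (1 + ρ))) ^ (1 + ρ) := by
  classical
  have hinner : ∀ y, 0 ≤ ∑ i, a i * W.prob (φ i) y ^ (1 / (1 + ρ)) := fun y =>
    Finset.sum_nonneg fun i _ => mul_nonneg (ha i) (Real.rpow_nonneg (W.prob_nonneg _ y) _)
  rcases (Finset.sum_nonneg fun i _ => ha i : 0 ≤ ∑ i, a i).eq_or_lt with h0 | h0
  · rw [← h0, Real.zero_rpow (by positivity), zero_mul]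
    exact Finset.sum_nonneg fun y _ => Real.rpow_nonneg (hinner y) _
  set A := ∑ i, a i with hA
  -- The normalized image of the weights under `φ` is an input law, to which `hg` applies.
  set Q : X → ℝ := fun x => (∑ i with φ i = x, a i) / A with hQ
  have hQmem : Q ∈ stdSimplex ℝ X := by
    refine ⟨fun x => div_nonneg (Finset.sum_nonneg fun i _ => ha i) h0.le, ?_⟩
    rw [← Finset.sum_div, Finset.sum_fiberwise Finset.univ φ a, ← hA, div_self h0.ne']
  calc A ^ (1 + ρ) * g ≤ A ^ (1 + ρ) * gallagerSum W ρ Q :=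
        mul_le_mul_of_nonneg_left (hg Q hQmem) (Real.rpow_nonneg h0.le _)
    _ = _ := by
        rw [gallagerSum, Finset.mul_sum]
        refine Finset.sum_congr rfl fun y _ => ?_
        rw [← Real.mul_rpow h0.le (gallagerInner_nonneg W hQmem.1 y), Finset.mul_sum,
          ← Finset.sum_fiberwise Finset.univ φ]
        congr 1
        refine Finset.sum_congr rfl fun x _ => ?_
        rw [hQ, ← mul_assoc, mul_div_cancel₀ _ h0.ne', Finset.sum_mul]
        refine Finset.sum_congr rfl fun i hi => ?_
        rw [(Finset.mem_filter.1 hi).2]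

end GallagerSum

/-! ### Feedback likelihoods and their recursion in the last channel use. -/

section Feedback

theorem outputPrefix_snoc_castSucc {Y : Type*} {n : ℕ} (y : Fin n → Y) (z : Y) (i : Fin n) :
    outputPrefix (Fin.snoc y z : Fin (n + 1) → Y) i.castSucc = outputPrefix y i := by
  funext j
  exact Fin.snoc_castSucc (α := fun _ => Y) z y (Fin.castLE i.isLt.le j)

theorem outputPrefix_snoc_last {Y : Type*} {n : ℕ} (y : Fin n → Y) (z : Y) :
    outputPrefix (Fin.snoc y z : Fin (n + 1) → Y) (Fin.last n) = y := by
  funext j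
  exact Fin.snoc_castSucc (α := fun _ => Y) z y j

variable {X Y : Type*} [Fintype Y] (W : DMC X Y) {M n : ℕ}

theorem feedbackLikelihood_nonneg (f : FeedbackEncoder X Y M n) (m : Fin M) (y : Fin n → Y) :
    0 ≤ feedbackLikelihood W f m y :=
  Finset.prod_nonneg fun _ _ => W.prob_nonneg _ _

/-- The restriction of a feedback encoder to all but the last channel use. -/
def FeedbackEncoder.init (f : FeedbackEncoder X Y M (n + 1)) : FeedbackEncoder X Y M n :=
  fun i m p => f i.castSucc m p

theorem feedbackLikelihood_snoc (f : FeedbackEncoder X Y M (n + 1)) (m : Fin M) (y : Fin n → Y)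
    (z : Y) :
    feedbackLikelihood W f m (Fin.snoc y z) =
      feedbackLikelihood W f.init m y * W.prob (f (Fin.last n) m y) z := by
  rw [feedbackLikelihood, Fin.prod_univ_castSucc, Fin.snoc_last, outputPrefix_snoc_last]
  congr 1
  refine Finset.prod_congr rfl fun i _ => ?_
  rw [Fin.snoc_castSucc (α := fun _ => Y), outputPrefix_snoc_castSucc]
  rfl

theorem sum_fin_succ_eq_sum_snoc (F : (Fin (n + 1) → Y) → ℝ) :
    ∑ y, F y = ∑ y : Fin n → Y, ∑ z, F (Fin.snoc y z) := by
  rw [← (Fin.snocEquiv fun _ => Y).sum_comp, Fintype.sum_prod_type, Finset.sum_comm]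
  rfl

theorem sum_feedbackLikelihood (m : Fin M) :
    ∀ {n : ℕ} (f : FeedbackEncoder X Y M n), ∑ y, feedbackLikelihood W f m y = 1
  | 0, f => by simp [feedbackLikelihood]
  | n + 1, f => by
    rw [sum_fin_succ_eq_sum_snoc]
    simp_rw [feedbackLikelihood_snoc, ← Finset.mul_sum, W.prob_sum, mul_one]
    exact sum_feedbackLikelihood m f.init

/-- Feedback does not help to decrease the Gallager sum below the product of its single-letter
minima. -/
theorem rpow_sum_mul_pow_le_sum_feedback [Fintype X] {ρ : ℝ} (hρ : 0 < ρ) {g : ℝ} (hg0 : 0 ≤ g)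
    (hg : ∀ Q ∈ stdSimplex ℝ X, g ≤ gallagerSum W ρ Q) (a : Fin M → ℝ) (ha : ∀ m, 0 ≤ a m) :
    ∀ {n : ℕ} (f : FeedbackEncoder X Y M n),
      (∑ m, a m) ^ (1 + ρ) * g ^ n ≤
        ∑ y, (∑ m, a m * feedbackLikelihood W f m y ^ (1 / (1 + ρ))) ^ (1 + ρ)
  | 0, f => by simp [feedbackLikelihood]
  | n + 1, f => by
    rw [sum_fin_succ_eq_sum_snoc, pow_succ, ← mul_assoc]
    refine (mul_le_mul_of_nonneg_right
      (rpow_sum_mul_pow_le_sum_feedback hρ hg0 hg a ha f.init) hg0).trans ?_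
    rw [Finset.sum_mul]
    refine Finset.sum_le_sum fun y _ => ?_
    -- With `y` fixed, the last input depends on the message alone, so the single-letter bound
    -- applies with the past likelihood powers as weights.
    refine (rpow_sum_mul_le_sum_rpow W hρ hg _ (fun m => mul_nonneg (ha m)
      (Real.rpow_nonneg (feedbackLikelihood_nonneg W f.init m y) _))
      (fun m => f (Fin.last n) m y)).trans_eq ?_
    simp_rw [feedbackLikelihood_snoc,
      Real.mul_rpow (feedbackLikelihood_nonneg W f.init _ y) (W.prob_nonneg _ _), mul_assoc]

end Feedback

/-! ### Ranks, Hölder's inequality and the converse bound. -/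

section ListSize

/-- The reciprocals of the ranks of the elements of `s` add up to at most a harmonic number. -/
theorem sum_inv_card_le_harmonic {ι : Type*} (v : ι → ℝ) (s : Finset ι) :
    ∑ i ∈ s, ((s.filter fun j => v i ≤ v j).card : ℝ)⁻¹ ≤ harmonic s.card := by
  classical
  -- The inserted element has the smallest value, so its rank is the full cardinality; the other
  -- ranks can only grow.
  induction s using Finset.induction_on_min_value v with
  | empty => simp
  | insert a s ha hmin ih =>
    rw [Finset.sum_insert ha, Finset.card_insert_of_notMem ha, harmonic_succ, add_comm]
    push_cast
    refine add_le_add (le_trans (Finset.sum_le_sum fun i hi => ?_) ih) ?_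
    · exact inv_anti₀
        (Nat.cast_pos.2 (Finset.card_pos.2 ⟨i, Finset.mem_filter.2 ⟨hi, le_rfl⟩⟩))
        (Nat.cast_le.2 (Finset.card_le_card
          (Finset.filter_subset_filter _ (Finset.subset_insert a s))))
    · rw [Finset.filter_true_of_mem, Finset.card_insert_of_notMem ha]
      · push_cast
        exact le_rfl
      · intro x hx
        rcases Finset.mem_insert.1 hx with rfl | hx
        · exact le_rfl
        · exact hmin x hx

/-- Hölder's inequality in the form used for moments of ranks. -/
theorem rpow_sum_rpow_le {ι : Type*} (s : Finset ι) {ρ : ℝ} (hρ : 0 < ρ) (w l : ι → ℝ)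
    (hw : ∀ i ∈ s, 0 ≤ w i) (hl : ∀ i ∈ s, 0 < l i) :
    (∑ i ∈ s, w i ^ (1 / (1 + ρ))) ^ (1 + ρ) ≤
      (∑ i ∈ s, w i * l i ^ ρ) * (∑ i ∈ s, (l i)⁻¹) ^ ρ := by
  have h1 : (1 : ℝ) + ρ ≠ 0 := by positivity
  have hconj : (1 + ρ).HolderConjugate ((1 + ρ) / ρ) := by
    rw [Real.holderConjugate_iff]
    refine ⟨by linarith, ?_⟩
    field_simp
  have hwl : ∀ i ∈ s, 0 ≤ w i * l i ^ ρ := fun i hi =>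
    mul_nonneg (hw i hi) (Real.rpow_nonneg (hl i hi).le _)
  have hinv : ∀ i ∈ s, 0 ≤ (l i)⁻¹ := fun i hi => inv_nonneg.2 (hl i hi).le
  -- The factors are chosen so that the powers of `l` cancel in the product.
  have key := Real.inner_le_Lp_mul_Lq_of_nonneg s hconj
    (f := fun i => (w i * l i ^ ρ) ^ (1 / (1 + ρ))) (g := fun i => ((l i)⁻¹) ^ (ρ / (1 + ρ)))
    (fun i hi => Real.rpow_nonneg (hwl i hi) _) (fun i hi => Real.rpow_nonneg (hinv i hi) _)
  have e1 : ∑ i ∈ s, (w i * l i ^ ρ) ^ (1 / (1 + ρ)) * ((l i)⁻¹) ^ (ρ / (1 + ρ)) =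
      ∑ i ∈ s, w i ^ (1 / (1 + ρ)) := by
    refine Finset.sum_congr rfl fun i hi => ?_
    have := hl i hi
    rw [Real.mul_rpow (hw i hi) (Real.rpow_nonneg this.le _), ← Real.rpow_mul this.le,
      mul_one_div, mul_assoc, Real.inv_rpow this.le, mul_inv_cancel₀ (by positivity), mul_one]
  have e2 : ∑ i ∈ s, ((w i * l i ^ ρ) ^ (1 / (1 + ρ))) ^ (1 + ρ) = ∑ i ∈ s, w i * l i ^ ρ := by
    refine Finset.sum_congr rfl fun i hi => ?_
    rw [← Real.rpow_mul (hwl i hi), one_div_mul_cancel h1, Real.rpow_one]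
  have e3 : ∑ i ∈ s, (((l i)⁻¹) ^ (ρ / (1 + ρ))) ^ ((1 + ρ) / ρ) = ∑ i ∈ s, (l i)⁻¹ := by
    refine Finset.sum_congr rfl fun i hi => ?_
    rw [← Real.rpow_mul (hinv i hi)]
    have : ρ / (1 + ρ) * ((1 + ρ) / ρ) = 1 := by field_simp
    rw [this, Real.rpow_one]
  rw [e1, e2, e3] at key
  have hA : 0 ≤ ∑ i ∈ s, w i * l i ^ ρ := Finset.sum_nonneg hwl
  have hB : 0 ≤ ∑ i ∈ s, (l i)⁻¹ := Finset.sum_nonneg hinv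
  refine (Real.rpow_le_rpow (Finset.sum_nonneg fun i hi => Real.rpow_nonneg (hw i hi) _) key
    (by positivity)).trans_eq ?_
  rw [Real.mul_rpow (Real.rpow_nonneg hA _) (Real.rpow_nonneg hB _), ← Real.rpow_mul hA,
    ← Real.rpow_mul hB, one_div_mul_cancel h1, Real.rpow_one]
  congr 2
  field_simp

variable {X Y : Type*} [Fintype Y] (W : DMC X Y) {M n : ℕ}

theorem one_le_card_likelyList (f : FeedbackEncoder X Y M n) (m : Fin M) (y : Fin n → Y) :
    1 ≤ (likelyList W f m y).card :=
  Finset.card_pos.2 ⟨m, Finset.mem_filter.2 ⟨Finset.mem_univ m, le_rfl⟩⟩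

theorem one_le_listMoment {ρ : ℝ} (hρ : 0 < ρ) (hM : 0 < M) (f : FeedbackEncoder X Y M n) :
    1 ≤ listMoment W ρ f := by
  have hM' : (0 : ℝ) < M := by exact_mod_cast hM
  rw [listMoment, inv_mul_eq_div, one_le_div hM']
  calc (M : ℝ) = ∑ m : Fin M, ∑ y, feedbackLikelihood W f m y := by
        simp [sum_feedbackLikelihood]
    _ ≤ _ := Finset.sum_le_sum fun m _ => Finset.sum_le_sum fun y _ =>
        le_mul_of_one_le_right (feedbackLikelihood_nonneg W f m y)
          (Real.one_le_rpow (by exact_mod_cast one_le_card_likelyList W f m y) hρ.le)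

/-- The converse bound: with feedback, the `ρ`-th moment of the list size is at least
`M ^ ρ * g ^ n` up to a logarithmic factor. -/
theorem rpow_mul_pow_le_listMoment [Fintype X] {ρ : ℝ} (hρ : 0 < ρ) {g : ℝ} (hg0 : 0 ≤ g)
    (hg : ∀ Q ∈ stdSimplex ℝ X, g ≤ gallagerSum W ρ Q) (hM : 0 < M)
    (f : FeedbackEncoder X Y M n) :
    (M : ℝ) ^ ρ * g ^ n ≤ listMoment W ρ f * (1 + Real.log M) ^ ρ := by
  have hM' : (0 : ℝ) < M := by exact_mod_cast hM
  have hpos : ∀ m y, (0 : ℝ) < (likelyList W f m y).card := fun m y => by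
    exact_mod_cast one_le_card_likelyList W f m y
  have h1 := rpow_sum_mul_pow_le_sum_feedback W hρ hg0 hg (fun _ : Fin M => (1 : ℝ))
    (fun _ => zero_le_one) f
  simp only [one_mul, Finset.sum_const, Finset.card_univ, Fintype.card_fin, nsmul_eq_mul,
    mul_one] at h1
  have h2 : ∀ y, (∑ m, feedbackLikelihood W f m y ^ (1 / (1 + ρ))) ^ (1 + ρ) ≤
      (∑ m, feedbackLikelihood W f m y * ((likelyList W f m y).card : ℝ) ^ ρ) *
        (1 + Real.log M) ^ ρ := fun y => by
    refine (rpow_sum_rpow_le _ hρ _ (fun m => ((likelyList W f m y).card : ℝ))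
      (fun m _ => feedbackLikelihood_nonneg W f m y) (fun m _ => hpos m y)).trans ?_
    refine mul_le_mul_of_nonneg_left (Real.rpow_le_rpow
      (Finset.sum_nonneg fun m _ => (inv_pos.2 (hpos m y)).le) ?_ hρ.le)
      (Finset.sum_nonneg fun m _ => mul_nonneg (feedbackLikelihood_nonneg W f m y)
        (Real.rpow_nonneg (hpos m y).le _))
    have h3 := sum_inv_card_le_harmonic (fun m => feedbackLikelihood W f m y) Finset.univ
    rw [Finset.card_univ, Fintype.card_fin] at h3
    exact h3.trans (harmonic_le_one_add_log M)
  -- One of the `1 + ρ` powers of `M` pays for averaging over messages.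
  have h4 := h1.trans (Finset.sum_le_sum fun y _ => h2 y)
  rw [← Finset.sum_mul, Finset.sum_comm, Real.rpow_add hM', Real.rpow_one] at h4
  rw [listMoment, mul_assoc, inv_mul_eq_div, le_div_iff₀ hM']
  linarith

end ListSize

/-! ### Moments of binomial variables. -/

section Binomial

/-- The factorial moments of a binomial random variable, realized on a finite product space. -/
theorem sum_prod_mul_choose_card {α : Type*} [Fintype α] (w : α → ℝ) (hw : ∑ x, w x = 1)
    (p : α → Prop) [DecidablePred p] :
    ∀ M j : ℕ, ∑ c : Fin M → α, (∏ i, w (c i)) *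
      ((Finset.univ.filter fun i => p (c i)).card.choose j : ℝ) =
        (M.choose j : ℝ) * (∑ x with p x, w x) ^ j
  | 0, j => by
    rcases j with _ | j <;> simp
  | M + 1, 0 => by
    simp only [Nat.choose_zero_right, Nat.cast_one, mul_one, pow_zero]
    rw [← Fintype.sum_pow, hw, one_pow]
  | M + 1, j + 1 => by
    have ih := sum_prod_mul_choose_card w hw p M
    rw [← (Fin.consEquiv fun _ => α).sum_comp, Fintype.sum_prod_type]
    -- Pascal's rule, according to whether the first coordinate is a success.
    have hcard : ∀ (x : α) (r : Fin M → α),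
        ((Finset.univ.filter fun i => p ((Fin.cons x r : Fin (M + 1) → α) i)).card.choose (j + 1)
          : ℝ) = ((Finset.univ.filter fun i => p (r i)).card.choose (j + 1) : ℝ) +
            (if p x then ((Finset.univ.filter fun i => p (r i)).card.choose j : ℝ) else 0) := by
      intro x r
      rw [Finset.card_filter, Fin.sum_univ_succ]
      simp only [Fin.cons_zero, Fin.cons_succ, ← Finset.card_filter]
      split_ifs
      · rw [add_comm 1, Nat.choose_succ_succ]
        push_cast
        ring
      · simp
    have hstep : ∀ x : α, ∑ r : Fin M → α,
        (∏ i, w ((Fin.consEquiv fun _ => α) (x, r) i)) *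
          ((Finset.univ.filter fun i => p ((Fin.consEquiv fun _ => α) (x, r) i)).card.choose
            (j + 1) : ℝ) =
        w x * ((M.choose (j + 1) : ℝ) * (∑ x with p x, w x) ^ (j + 1)) +
          (if p x then w x else 0) * ((M.choose j : ℝ) * (∑ x with p x, w x) ^ j) := by
      intro x
      rw [← ih, ← ih, Finset.mul_sum, Finset.mul_sum, ← Finset.sum_add_distrib]
      refine Finset.sum_congr rfl fun r _ => ?_
      have h1 := hcard x r
      have h2 : ∏ i, w ((Fin.cons x r : Fin (M + 1) → α) i) = w x * ∏ i, w (r i) := by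
        rw [Fin.prod_univ_succ]
        simp
      change (∏ i, w ((Fin.cons x r : Fin (M + 1) → α) i)) * _ = _
      rw [h2]
      refine (congrArg _ h1).trans ?_
      split_ifs <;> ring
    rw [Finset.sum_congr rfl fun x _ => hstep x, Finset.sum_add_distrib, ← Finset.sum_mul,
      ← Finset.sum_mul, hw, ← Finset.sum_filter, Nat.choose_succ_succ]
    push_cast
    ring

/-- A power is bounded by a combination of the first and the highest binomial coefficient. -/
theorem pow_le_mul_add_choose (k z : ℕ) (hk : 1 ≤ k) :
    (z : ℝ) ^ k ≤ (k : ℝ) ^ k * k.factorial * (z + z.choose k) := by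
  have hk' : (1 : ℝ) ≤ k := by exact_mod_cast hk
  have hf : (1 : ℝ) ≤ k.factorial := by exact_mod_cast Nat.one_le_iff_ne_zero.2 k.factorial_ne_zero
  have hz0 : (0 : ℝ) ≤ z := z.cast_nonneg
  rcases le_or_gt z k with hz | hz
  · rcases Nat.eq_zero_or_pos z with rfl | hz1
    · rw [Nat.cast_zero, zero_pow (by omega)]
      positivity
    have hz1' : (1 : ℝ) ≤ z := by exact_mod_cast hz1
    calc (z : ℝ) ^ k ≤ (k : ℝ) ^ k := pow_le_pow_left₀ hz0 (by exact_mod_cast hz) k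
      _ = (k : ℝ) ^ k * 1 * 1 := by ring
      _ ≤ _ := by
        gcongr
        have : (0 : ℝ) ≤ z.choose k := Nat.cast_nonneg _
        linarith
  -- The difference of the two sides is `(k - 1) * (z - k)`.
  · have h1 : (z : ℝ) ≤ k * ((z + 1 - k : ℕ) : ℝ) := by
      rw [Nat.cast_sub (by omega)]
      push_cast
      have : (k : ℝ) ≤ z := by exact_mod_cast hz.le
      nlinarith
    have h2 := Nat.pow_le_choose (α := ℝ) k z
    rw [div_le_iff₀ (by positivity)] at h2
    calc (z : ℝ) ^ k ≤ (k * ((z + 1 - k : ℕ) : ℝ)) ^ k := pow_le_pow_left₀ hz0 h1 k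
      _ = (k : ℝ) ^ k * ((z + 1 - k : ℕ) : ℝ) ^ k := mul_pow _ _ _
      _ ≤ (k : ℝ) ^ k * (z.choose k * k.factorial) := by gcongr
      _ = (k : ℝ) ^ k * k.factorial * (0 + z.choose k) := by ring
      _ ≤ _ := by gcongr

theorem sum_prod_mul_card_pow_le {α : Type*} [Fintype α] (w : α → ℝ) (hw0 : ∀ x, 0 ≤ w x)
    (hw : ∑ x, w x = 1) (p : α → Prop) [DecidablePred p] (M k : ℕ) (hk : 1 ≤ k) {u : ℝ}
    (hu : (M : ℝ) * ∑ x with p x, w x ≤ u) :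
    ∑ c : Fin M → α, (∏ i, w (c i)) * ((Finset.univ.filter fun i => p (c i)).card : ℝ) ^ k ≤
      (k : ℝ) ^ k * k.factorial * (u + u ^ k) := by
  have hp0 : 0 ≤ ∑ x with p x, w x := Finset.sum_nonneg fun x _ => hw0 x
  have h1 := sum_prod_mul_choose_card w hw p M 1
  have h2 := sum_prod_mul_choose_card w hw p M k
  simp only [Nat.choose_one_right, pow_one] at h1
  calc _ ≤ ∑ c : Fin M → α, (∏ i, w (c i)) * ((k : ℝ) ^ k * k.factorial *
        ((Finset.univ.filter fun i => p (c i)).card +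
          (Finset.univ.filter fun i => p (c i)).card.choose k)) :=
        Finset.sum_le_sum fun c _ => mul_le_mul_of_nonneg_left (pow_le_mul_add_choose _ _ hk)
          (Finset.prod_nonneg fun i _ => hw0 _)
    _ = (k : ℝ) ^ k * k.factorial * (M * (∑ x with p x, w x) +
          M.choose k * (∑ x with p x, w x) ^ k) := by
        rw [← h1, ← h2, ← Finset.sum_add_distrib, Finset.mul_sum]
        exact Finset.sum_congr rfl fun c _ => by ring
    _ ≤ _ := by
        refine mul_le_mul_of_nonneg_left (add_le_add hu ?_) (by positivity)
        refine le_trans ?_ (pow_le_pow_left₀ (by positivity) hu k)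
        rw [mul_pow]
        refine mul_le_mul_of_nonneg_right ?_ (by positivity)
        exact_mod_cast Nat.choose_le_pow M k

/-- Jensen's inequality for a concave power. -/
theorem sum_mul_rpow_le_rpow_sum {ι : Type*} (s : Finset ι) (w z : ι → ℝ)
    (hw0 : ∀ i ∈ s, 0 ≤ w i) (hw : ∑ i ∈ s, w i = 1) (hz : ∀ i ∈ s, 0 ≤ z i) {t : ℝ}
    (ht0 : 0 < t) (ht1 : t ≤ 1) : ∑ i ∈ s, w i * z i ^ t ≤ (∑ i ∈ s, w i * z i) ^ t := by
  have h := Real.rpow_arith_mean_le_arith_mean_rpow s w (fun i => z i ^ t) hw0 hw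
    (fun i hi => Real.rpow_nonneg (hz i hi) _) (p := 1 / t) ((one_le_div ht0).2 ht1)
  have h0 : 0 ≤ ∑ i ∈ s, w i * z i ^ t :=
    Finset.sum_nonneg fun i hi => mul_nonneg (hw0 i hi) (Real.rpow_nonneg (hz i hi) _)
  have e : ∑ i ∈ s, w i * (z i ^ t) ^ (1 / t) = ∑ i ∈ s, w i * z i :=
    Finset.sum_congr rfl fun i hi => by
      rw [← Real.rpow_mul (hz i hi), mul_one_div_cancel ht0.ne', Real.rpow_one]
  rw [e] at h
  have h' := Real.rpow_le_rpow (Real.rpow_nonneg h0 _) h ht0.le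
  rwa [← Real.rpow_mul h0, one_div_mul_cancel ht0.ne', Real.rpow_one] at h'

theorem one_add_natCast_rpow_le {ρ : ℝ} (hρ : 0 < ρ) (z : ℕ) :
    (1 + (z : ℝ)) ^ ρ ≤ 1 + 2 ^ ρ * (z : ℝ) ^ ρ := by
  rcases Nat.eq_zero_or_pos z with rfl | hz
  · simp [Real.zero_rpow hρ.ne']
  · have hz' : (1 : ℝ) ≤ z := by exact_mod_cast hz
    rw [← Real.mul_rpow zero_le_two (by linarith)]
    have := Real.rpow_le_rpow (by linarith) (show 1 + (z : ℝ) ≤ 2 * z by linarith) hρ.le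
    linarith

/-- The `ρ`-th moment of one plus a binomial random variable of mean at most `u`. -/
theorem sum_prod_mul_one_add_card_rpow_le {α : Type*} [Fintype α] (w : α → ℝ)
    (hw0 : ∀ x, 0 ≤ w x) (hw : ∑ x, w x = 1) (p : α → Prop) [DecidablePred p] (M k : ℕ)
    {ρ : ℝ} (hρ : 0 < ρ) (hk : ρ ≤ k) {u : ℝ} (hu : (M : ℝ) * ∑ x with p x, w x ≤ u) :
    ∑ c : Fin M → α, (∏ i, w (c i)) *
        (1 + ((Finset.univ.filter fun i => p (c i)).card : ℝ)) ^ ρ ≤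
      1 + 2 ^ ρ * ((k : ℝ) ^ k * k.factorial) ^ (ρ / k) * (u ^ (ρ / k) + u ^ ρ) := by
  have hk0 : (0 : ℝ) < k := hρ.trans_le hk
  have hk1 : 1 ≤ k := by exact_mod_cast hk0
  have hu0 : 0 ≤ u := le_trans (mul_nonneg M.cast_nonneg (Finset.sum_nonneg fun x _ => hw0 x)) hu
  have hprod0 : ∀ c : Fin M → α, 0 ≤ ∏ i, w (c i) := fun c => Finset.prod_nonneg fun i _ => hw0 _
  have hprod : ∑ c : Fin M → α, ∏ i, w (c i) = 1 := by
    rw [← Fintype.sum_pow, hw, one_pow]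
  set Z : (Fin M → α) → ℝ := fun c => ((Finset.univ.filter fun i => p (c i)).card : ℝ) with hZ
  have hZ0 : ∀ c, 0 ≤ Z c := fun c => Nat.cast_nonneg _
  have hZρ : ∑ c, (∏ i, w (c i)) * Z c ^ ρ ≤
      ((k : ℝ) ^ k * k.factorial) ^ (ρ / k) * (u ^ (ρ / k) + u ^ ρ) := by
    -- Jensen with exponent `ρ / k ≤ 1` reduces the real moment to the integer moment of order `k`.
    calc ∑ c, (∏ i, w (c i)) * Z c ^ ρ = ∑ c, (∏ i, w (c i)) * (Z c ^ k) ^ (ρ / k) := by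
          refine Finset.sum_congr rfl fun c _ => ?_
          rw [← Real.rpow_natCast, ← Real.rpow_mul (hZ0 c), mul_div_cancel₀ _ hk0.ne']
      _ ≤ (∑ c, (∏ i, w (c i)) * Z c ^ k) ^ (ρ / k) :=
          sum_mul_rpow_le_rpow_sum _ _ _ (fun c _ => hprod0 c) hprod
            (fun c _ => pow_nonneg (hZ0 c) k) (div_pos hρ hk0) ((div_le_one hk0).2 hk)
      _ ≤ ((k : ℝ) ^ k * k.factorial * (u + u ^ k)) ^ (ρ / k) :=
          Real.rpow_le_rpow (Finset.sum_nonneg fun c _ => mul_nonneg (hprod0 c)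
            (pow_nonneg (hZ0 c) k)) (sum_prod_mul_card_pow_le w hw0 hw p M k hk1 hu)
            (by positivity)
      _ = ((k : ℝ) ^ k * k.factorial) ^ (ρ / k) * (u + u ^ k) ^ (ρ / k) :=
          Real.mul_rpow (by positivity) (by positivity)
      _ ≤ _ := by
          refine mul_le_mul_of_nonneg_left ?_ (by positivity)
          refine (Real.rpow_add_le_add_rpow hu0 (by positivity) (by positivity)
            ((div_le_one hk0).2 hk)).trans_eq ?_
          rw [← Real.rpow_natCast, ← Real.rpow_mul hu0, mul_div_cancel₀ _ hk0.ne']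
  calc _ ≤ ∑ c, (∏ i, w (c i)) * (1 + 2 ^ ρ * Z c ^ ρ) :=
        Finset.sum_le_sum fun c _ =>
          mul_le_mul_of_nonneg_left (one_add_natCast_rpow_le hρ _) (hprod0 c)
    _ = 1 + 2 ^ ρ * ∑ c, (∏ i, w (c i)) * Z c ^ ρ := by
        simp_rw [mul_add, mul_one]
        rw [Finset.sum_add_distrib, hprod, Finset.mul_sum]
        congr 1
        exact Finset.sum_congr rfl fun c _ => by ring
    _ ≤ _ := by
        rw [mul_assoc]
        gcongr

end Binomial

/-! ### One-shot random coding. -/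

section RandomCoding

variable {X Y : Type*} [Fintype X] [Fintype Y] (W : DMC X Y) {ρ : ℝ} {P : X → ℝ}

/-- The random coding bound on the mean number of competitors, before multiplication with the
number of messages. -/
theorem sum_filter_le_div (hρ : 0 < ρ) (hP : ∀ x, 0 ≤ P x) {x : X} {y : Y}
    (h : 0 < W.prob x y) :
    ∑ x' with W.prob x y ≤ W.prob x' y, P x' ≤
      (∑ x', P x' * W.prob x' y ^ (1 / (1 + ρ))) / W.prob x y ^ (1 / (1 + ρ)) := by
  have hs : (0 : ℝ) ≤ 1 / (1 + ρ) := by positivity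
  have hpos : 0 < W.prob x y ^ (1 / (1 + ρ)) := Real.rpow_pos_of_pos h _
  -- Markov's inequality for the likelihood raised to the power `1 / (1 + ρ)`.
  rw [le_div_iff₀ hpos, Finset.sum_mul]
  refine (Finset.sum_le_sum fun x' hx' => mul_le_mul_of_nonneg_left
    (Real.rpow_le_rpow h.le (Finset.mem_filter.1 hx').2 hs) (hP x')).trans ?_
  exact Finset.sum_le_sum_of_subset_of_nonneg (Finset.filter_subset _ _) fun x' _ _ =>
    mul_nonneg (hP x') (Real.rpow_nonneg (W.prob_nonneg x' y) _)

/-- With `s = 1 / (1 + ρ)`, dividing `W` by `(W ^ s) ^ ρ` leaves `W ^ s`; summing over `x` rebuilds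
the inner sum, raising its power from `ρ` to `1 + ρ`. -/
theorem sum_sum_mul_rpow_eq (hρ : 0 < ρ) (hP : ∀ x, 0 ≤ P x) (M : ℕ) :
    ∑ x, ∑ y, P x * W.prob x y * ((M : ℝ) * ((∑ x', P x' * W.prob x' y ^ (1 / (1 + ρ))) /
      W.prob x y ^ (1 / (1 + ρ)))) ^ ρ = (M : ℝ) ^ ρ * gallagerSum W ρ P := by
  rw [Finset.sum_comm, gallagerSum, Finset.mul_sum]
  refine Finset.sum_congr rfl fun y _ => ?_
  set S := ∑ x', P x' * W.prob x' y ^ (1 / (1 + ρ)) with hS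
  have hS0 : 0 ≤ S := gallagerInner_nonneg W hP y
  have hterm : ∀ x, P x * W.prob x y * ((M : ℝ) * (S / W.prob x y ^ (1 / (1 + ρ)))) ^ ρ =
      (M : ℝ) ^ ρ * S ^ ρ * (P x * W.prob x y ^ (1 / (1 + ρ))) := by
    intro x
    rcases (W.prob_nonneg x y).eq_or_lt with h | h
    · rw [← h, Real.zero_rpow (by positivity)]
      simp
    · have hpos : 0 < W.prob x y ^ (1 / (1 + ρ)) := Real.rpow_pos_of_pos h _
      rw [Real.mul_rpow M.cast_nonneg (div_nonneg hS0 hpos.le), Real.div_rpow hS0 hpos.le]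
      have e : W.prob x y = W.prob x y ^ (1 / (1 + ρ)) * (W.prob x y ^ (1 / (1 + ρ))) ^ ρ := by
        rw [← Real.rpow_one_add' hpos.le (by positivity), ← Real.rpow_mul h.le,
          one_div_mul_cancel (by positivity), Real.rpow_one]
      have hpos' : 0 < (W.prob x y ^ (1 / (1 + ρ))) ^ ρ := Real.rpow_pos_of_pos hpos _
      nth_rewrite 1 [e]
      field_simp
  rw [Finset.sum_congr rfl fun x _ => hterm x, ← Finset.mul_sum, ← hS, mul_assoc]
  congr 1
  rw [add_comm, Real.rpow_add_one' hS0 (by positivity)]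

/-- The one-shot random coding bound for a single message, averaged over all codebooks. -/
theorem sum_codebook_le (hρ : 0 < ρ) (hP : P ∈ stdSimplex ℝ X) {k : ℕ} (hk : ρ ≤ k) {M : ℕ}
    (m : Fin M) :
    ∑ c : Fin M → X, (∏ i, P (c i)) * ∑ y, W.prob (c m) y *
        ((Finset.univ.filter fun m' => W.prob (c m) y ≤ W.prob (c m') y).card : ℝ) ^ ρ ≤
      1 + 2 ^ ρ * ((k : ℝ) ^ k * k.factorial) ^ (ρ / k) *
        (((M : ℝ) ^ ρ * gallagerSum W ρ P) ^ (1 / (k : ℝ)) + (M : ℝ) ^ ρ * gallagerSum W ρ P) := by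
  obtain _ | M := M
  · exact m.elim0
  have hk0 : (0 : ℝ) < k := hρ.trans_le hk
  have hk1 : (1 : ℝ) ≤ k := by
    have : 1 ≤ k := by exact_mod_cast hk0
    exact_mod_cast this
  set C : ℝ := 2 ^ ρ * ((k : ℝ) ^ k * k.factorial) ^ (ρ / k) with hC
  set u : X → Y → ℝ := fun x y => ((M + 1 : ℕ) : ℝ) *
    ((∑ x', P x' * W.prob x' y ^ (1 / (1 + ρ))) / W.prob x y ^ (1 / (1 + ρ))) with hu
  have hu0 : ∀ x y, 0 ≤ u x y := fun x y => mul_nonneg (Nat.cast_nonneg _)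
    (div_nonneg (gallagerInner_nonneg W hP.1 y) (Real.rpow_nonneg (W.prob_nonneg x y) _))
  have hone : ∀ x y, W.prob x y * ∑ r : Fin M → X, (∏ i, P (r i)) *
      (1 + ((Finset.univ.filter fun i => W.prob x y ≤ W.prob (r i) y).card : ℝ)) ^ ρ ≤
        W.prob x y * (1 + C * (u x y ^ (ρ / k) + u x y ^ ρ)) := by
    intro x y
    rcases (W.prob_nonneg x y).eq_or_lt with h | h
    · simp [← h]
    refine mul_le_mul_of_nonneg_left (sum_prod_mul_one_add_card_rpow_le P hP.1 hP.2
      (fun x' => W.prob x y ≤ W.prob x' y) M k hρ hk ?_) h.le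
    refine mul_le_mul ?_ (sum_filter_le_div W hρ hP.1 h)
      (Finset.sum_nonneg fun x' _ => hP.1 x') (Nat.cast_nonneg _)
    exact_mod_cast M.le_succ
  have hsplit : ∑ c : Fin (M + 1) → X, (∏ i, P (c i)) * ∑ y, W.prob (c m) y *
        ((Finset.univ.filter fun m' => W.prob (c m) y ≤ W.prob (c m') y).card : ℝ) ^ ρ =
      -- Separating the codeword of `m` leaves `M` independent competitors; the summand `1` is `m`
      -- itself.
      ∑ x, ∑ y, P x * (W.prob x y * ∑ r : Fin M → X, (∏ i, P (r i)) *
        (1 + ((Finset.univ.filter fun i => W.prob x y ≤ W.prob (r i) y).card : ℝ)) ^ ρ) := by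
    rw [← (Fin.insertNthEquiv (fun _ => X) m).sum_comp, Fintype.sum_prod_type]
    refine Finset.sum_congr rfl fun x _ => ?_
    simp_rw [Finset.mul_sum]
    rw [Finset.sum_comm]
    refine Finset.sum_congr rfl fun y _ => Finset.sum_congr rfl fun r _ => ?_
    have e0 : (Fin.insertNthEquiv (fun _ => X) m) (x, r) = Fin.insertNth m x r := rfl
    rw [e0, Fin.prod_univ_succAbove _ m, Finset.card_filter, Fin.sum_univ_succAbove _ m]
    simp only [Fin.insertNth_apply_same, Fin.insertNth_apply_succAbove, le_refl, if_true,
      ← Finset.card_filter]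
    push_cast
    ring
  have hweight : ∑ q : X × Y, P q.1 * W.prob q.1 q.2 = 1 := by
    rw [Fintype.sum_prod_type]
    simp_rw [← Finset.mul_sum, W.prob_sum, mul_one]
    exact hP.2
  have hmoment : ∑ q : X × Y, P q.1 * W.prob q.1 q.2 * u q.1 q.2 ^ ρ =
      ((M + 1 : ℕ) : ℝ) ^ ρ * gallagerSum W ρ P := by
    rw [Fintype.sum_prod_type]
    exact sum_sum_mul_rpow_eq W hρ hP.1 (M + 1)
  -- A second Jensen step, with exponent `1 / k` and over input-output pairs, brings the lower-order
  -- term back to Gallager's sum.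
  have hjensen : ∑ q : X × Y, P q.1 * W.prob q.1 q.2 * u q.1 q.2 ^ (ρ / k) ≤
      (((M + 1 : ℕ) : ℝ) ^ ρ * gallagerSum W ρ P) ^ (1 / (k : ℝ)) := by
    rw [← hmoment]
    refine le_trans (le_of_eq ?_) (sum_mul_rpow_le_rpow_sum Finset.univ
      (fun q : X × Y => P q.1 * W.prob q.1 q.2) (fun q => u q.1 q.2 ^ ρ)
      (fun q _ => mul_nonneg (hP.1 _) (W.prob_nonneg _ _)) hweight
      (fun q _ => Real.rpow_nonneg (hu0 _ _) _) (by positivity) ((div_le_one hk0).2 hk1))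
    refine Finset.sum_congr rfl fun q _ => ?_
    rw [← Real.rpow_mul (hu0 _ _), mul_one_div]
  calc _ = _ := hsplit
    _ ≤ ∑ x, ∑ y, P x * (W.prob x y * (1 + C * (u x y ^ (ρ / k) + u x y ^ ρ))) :=
        Finset.sum_le_sum fun x _ => Finset.sum_le_sum fun y _ =>
          mul_le_mul_of_nonneg_left (hone x y) (hP.1 x)
    _ = ∑ q : X × Y, (P q.1 * W.prob q.1 q.2 + C * (P q.1 * W.prob q.1 q.2 *
          u q.1 q.2 ^ (ρ / k) + P q.1 * W.prob q.1 q.2 * u q.1 q.2 ^ ρ)) := by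
        rw [Fintype.sum_prod_type]
        exact Finset.sum_congr rfl fun x _ => Finset.sum_congr rfl fun y _ => by ring
    _ = 1 + C * (∑ q : X × Y, P q.1 * W.prob q.1 q.2 * u q.1 q.2 ^ (ρ / k) +
          ((M + 1 : ℕ) : ℝ) ^ ρ * gallagerSum W ρ P) := by
        rw [Finset.sum_add_distrib, hweight, ← Finset.mul_sum, Finset.sum_add_distrib, hmoment]
    _ ≤ _ := by
        have : 0 ≤ C := by positivity
        gcongr

/-- The one-shot random coding bound. -/
theorem exists_codebook_le (hρ : 0 < ρ) (hP : P ∈ stdSimplex ℝ X) {k : ℕ} (hk : ρ ≤ k) {M : ℕ}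
    (hM : 0 < M) :
    ∃ c : Fin M → X, (M : ℝ)⁻¹ * ∑ m, ∑ y, W.prob (c m) y *
        ((Finset.univ.filter fun m' => W.prob (c m) y ≤ W.prob (c m') y).card : ℝ) ^ ρ ≤
      1 + 2 ^ ρ * ((k : ℝ) ^ k * k.factorial) ^ (ρ / k) *
        (((M : ℝ) ^ ρ * gallagerSum W ρ P) ^ (1 / (k : ℝ)) + (M : ℝ) ^ ρ * gallagerSum W ρ P) := by
  have hM' : (0 : ℝ) < M := by exact_mod_cast hM
  set B := 1 + 2 ^ ρ * ((k : ℝ) ^ k * k.factorial) ^ (ρ / k) *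
    (((M : ℝ) ^ ρ * gallagerSum W ρ P) ^ (1 / (k : ℝ)) + (M : ℝ) ^ ρ * gallagerSum W ρ P) with hB
  set F : (Fin M → X) → Fin M → ℝ := fun c m => ∑ y, W.prob (c m) y *
    ((Finset.univ.filter fun m' => W.prob (c m) y ≤ W.prob (c m') y).card : ℝ) ^ ρ with hF
  have havg : ∑ c : Fin M → X, (∏ i, P (c i)) * ∑ m, F c m ≤ M * B := by
    simp_rw [Finset.mul_sum]
    rw [Finset.sum_comm]
    refine (Finset.sum_le_sum fun m _ => sum_codebook_le W hρ hP hk m).trans_eq ?_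
    rw [Finset.sum_const, Finset.card_univ, Fintype.card_fin, nsmul_eq_mul]
  have hprod : ∑ c : Fin M → X, ∏ i, P (c i) = 1 := by
    rw [← Fintype.sum_pow, hP.2, one_pow]
  by_contra! hcon
  have hlt : ∀ c, M * B < ∑ m, F c m := fun c => by
    have := hcon c
    rwa [lt_inv_mul_iff₀ hM'] at this
  obtain ⟨c, hc⟩ : ∃ c : Fin M → X, 0 < ∏ i, P (c i) := by
    by_contra! h
    have : ∑ c : Fin M → X, ∏ i, P (c i) ≤ 0 := Finset.sum_nonpos fun c _ => h c
    linarith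
  have hstrict : ∑ c : Fin M → X, (∏ i, P (c i)) * (M * B) <
      ∑ c : Fin M → X, (∏ i, P (c i)) * ∑ m, F c m :=
    Finset.sum_lt_sum (fun c _ => mul_le_mul_of_nonneg_left (hlt c).le
      (Finset.prod_nonneg fun i _ => hP.1 _))
      ⟨c, Finset.mem_univ c, mul_lt_mul_of_pos_left (hlt c) hc⟩
  rw [← Finset.sum_mul, hprod, one_mul] at hstrict
  linarith

end RandomCoding

/-! ### Passage to blocklength `n`. -/

section Product

variable {X Y : Type*} [Fintype Y] (W : DMC X Y)

/-- The `n`-fold memoryless extension of a channel, without feedback. -/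
noncomputable def DMC.memorylessPow (n : ℕ) : DMC (Fin n → X) (Fin n → Y) where
  prob x y := ∏ i, W.prob (x i) (y i)
  prob_nonneg x y := Finset.prod_nonneg fun i _ => W.prob_nonneg _ _
  prob_sum x := by
    classical
    rw [← Fintype.piFinset_univ, ← Finset.prod_univ_sum (fun _ => Finset.univ)
      (fun i y => W.prob (x i) y)]
    simp [W.prob_sum]

variable [Fintype X] {P : X → ℝ}

theorem prod_mem_stdSimplex (hP : P ∈ stdSimplex ℝ X) (n : ℕ) :
    (fun x : Fin n → X => ∏ i, P (x i)) ∈ stdSimplex ℝ (Fin n → X) :=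
  ⟨fun x => Finset.prod_nonneg fun i _ => hP.1 _, by
    rw [← Fintype.sum_pow, hP.2, one_pow]⟩

/-- Under a product law both the inner and the outer sum factor over coordinates. -/
theorem gallagerSum_memorylessPow {ρ : ℝ} (hP : ∀ x, 0 ≤ P x) (n : ℕ) :
    gallagerSum (W.memorylessPow n) ρ (fun x => ∏ i, P (x i)) = gallagerSum W ρ P ^ n := by
  classical
  have hinner : ∀ y : Fin n → Y, ∑ x : Fin n → X, (∏ i, P (x i)) *
      (W.memorylessPow n).prob x y ^ (1 / (1 + ρ)) =
        ∏ i, ∑ x, P x * W.prob x (y i) ^ (1 / (1 + ρ)) := by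
    intro y
    rw [Finset.prod_univ_sum, Fintype.piFinset_univ]
    refine Finset.sum_congr rfl fun x _ => ?_
    rw [DMC.memorylessPow, ← Real.finsetProd_rpow _ _ fun i _ => W.prob_nonneg _ _,
      ← Finset.prod_mul_distrib]
  rw [gallagerSum, gallagerSum, Fintype.sum_pow]
  refine Finset.sum_congr rfl fun y _ => ?_
  rw [hinner, ← Real.finsetProd_rpow _ _ fun i _ => gallagerInner_nonneg W hP (y i)]

/-- The encoder that ignores the feedback and sends the codewords of the codebook `c`. -/
def FeedbackEncoder.ofCodebook {X Y : Type*} {M n : ℕ} (c : Fin M → Fin n → X) :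
    FeedbackEncoder X Y M n :=
  fun i m _ => c m i

theorem exists_listMoment_le {ρ : ℝ} (hρ : 0 < ρ) (hP : P ∈ stdSimplex ℝ X) {k : ℕ}
    (hk : ρ ≤ k) {M : ℕ} (hM : 0 < M) (n : ℕ) :
    ∃ f : FeedbackEncoder X Y M n, listMoment W ρ f ≤
      1 + 2 ^ ρ * ((k : ℝ) ^ k * k.factorial) ^ (ρ / k) *
        (((M : ℝ) ^ ρ * gallagerSum W ρ P ^ n) ^ (1 / (k : ℝ)) +
          (M : ℝ) ^ ρ * gallagerSum W ρ P ^ n) := by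
  obtain ⟨c, hc⟩ := exists_codebook_le (W.memorylessPow n) hρ (prod_mem_stdSimplex hP n) hk hM
  rw [gallagerSum_memorylessPow W hP.1] at hc
  exact ⟨FeedbackEncoder.ofCodebook c, hc⟩

end Product

/-! ### Asymptotics in the blocklength. -/

section CutoffRate

theorem messageCount_pos {R : ℝ} (hR : 0 ≤ R) (n : ℕ) : 0 < messageCount R n :=
  Nat.floor_pos.2 (Real.one_le_exp (by positivity))

theorem messageCount_le {R : ℝ} (n : ℕ) : (messageCount R n : ℝ) ≤ Real.exp (n * R) :=
  Nat.floor_le (Real.exp_pos _).le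

theorem exp_div_two_le_messageCount {R : ℝ} (hR : 0 ≤ R) (n : ℕ) :
    Real.exp (n * R) / 2 ≤ messageCount R n := by
  have h1 : (1 : ℝ) ≤ messageCount R n := by exact_mod_cast messageCount_pos hR n
  have h2 : Real.exp (n * R) < messageCount R n + 1 := Nat.lt_floor_add_one _
  linarith

/-- The base on the right is below or above one according as `ρ * R` is below or above `-log g`. -/
theorem exp_mul_rpow_mul_pow (R ρ g : ℝ) (n : ℕ) (hg : 0 < g) :
    Real.exp (n * R) ^ ρ * g ^ n = Real.exp (ρ * R + Real.log g) ^ n := by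
  rw [← Real.exp_mul, ← Real.exp_nat_mul, mul_add, Real.exp_add, ← Real.log_pow,
    Real.exp_log (by positivity)]
  ring_nf

theorem zero_mem_feedbackCutoffRates {X Y : Type*} [Nonempty X] [Fintype Y] (W : DMC X Y)
    {ρ : ℝ} : 0 ∈ feedbackCutoffRates W ρ := by
  have hM : ∀ n, messageCount 0 n = 1 := fun n => by simp [messageCount]
  refine ⟨le_rfl, fun n i m p => Classical.arbitrary X, tendsto_const_nhds.congr fun n => ?_⟩
  symm
  have : ∀ {M : ℕ} (f : FeedbackEncoder X Y M n), M = 1 → listMoment W ρ f = 1 := by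
    rintro M f rfl
    have hL : ∀ (m : Fin 1) y, (likelyList W f m y).card = 1 := fun m y =>
      le_antisymm ((Finset.card_le_univ _).trans_eq (Fintype.card_fin 1))
        (one_le_card_likelyList W f m y)
    simp [listMoment, hL, sum_feedbackLikelihood]
  exact this _ (hM n)

variable {X Y : Type*} [Fintype X] [Fintype Y] (W : DMC X Y) {ρ : ℝ}

/-- Every nonnegative rate below `E₀(ρ, P) / ρ` is achievable. -/
theorem mem_feedbackCutoffRates_of_lt (hρ : 0 < ρ) {P : X → ℝ} (hP : P ∈ stdSimplex ℝ X) {R : ℝ}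
    (hR : 0 ≤ R) (h : R < gallagerE0 W ρ P / ρ) : R ∈ feedbackCutoffRates W ρ := by
  refine ⟨hR, ?_⟩
  obtain ⟨k, hk⟩ := exists_nat_ge ρ
  have hk0 : (0 : ℝ) < k := hρ.trans_le hk
  have hg := gallagerSum_pos W (ρ := ρ) hP
  choose f hf using fun n => exists_listMoment_le W hρ hP hk (messageCount_pos hR n) n
  refine ⟨f, ?_⟩
  have hq : Real.exp (ρ * R + Real.log (gallagerSum W ρ P)) < 1 := by
    rw [Real.exp_lt_one_iff]
    rw [lt_div_iff₀ hρ, gallagerE0_eq_neg_log] at h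
    linarith
  have hT : Tendsto (fun n => (messageCount R n : ℝ) ^ ρ * gallagerSum W ρ P ^ n) atTop (𝓝 0) := by
    refine squeeze_zero (fun n => by positivity) (fun n => ?_)
      (tendsto_pow_atTop_nhds_zero_of_lt_one (Real.exp_pos _).le hq)
    rw [← exp_mul_rpow_mul_pow R ρ _ n hg]
    exact mul_le_mul_of_nonneg_right (Real.rpow_le_rpow (Nat.cast_nonneg _) (messageCount_le n)
      hρ.le) (by positivity)
  have hT' := hT.rpow_const (p := 1 / (k : ℝ)) (Or.inr (by positivity))
  rw [Real.zero_rpow (by positivity)] at hT'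
  have hlim := ((hT'.add hT).const_mul
    (2 ^ ρ * ((k : ℝ) ^ k * k.factorial) ^ (ρ / k))).const_add 1
  rw [add_zero, mul_zero, add_zero] at hlim
  exact tendsto_of_tendsto_of_tendsto_of_le_of_le tendsto_const_nhds hlim
    (fun n => one_le_listMoment W hρ (messageCount_pos hR n) (f n)) hf

/-- No rate above the largest value of `E₀(ρ, P) / ρ` is achievable, even with feedback. -/
theorem le_of_mem_feedbackCutoffRates (hρ : 0 < ρ) {g : ℝ} (hg0 : 0 < g)
    (hg : ∀ Q ∈ stdSimplex ℝ X, g ≤ gallagerSum W ρ Q) {R : ℝ}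
    (hR : R ∈ feedbackCutoffRates W ρ) : R ≤ -Real.log g / ρ := by
  obtain ⟨hR0, f, hf⟩ := hR
  by_contra! hlt
  rw [div_lt_iff₀ hρ] at hlt
  set q := Real.exp (ρ * R + Real.log g) with hq
  -- The factor `2` absorbs the floor in the message count.
  have hbound : ∀ n : ℕ, q ^ n ≤ listMoment W ρ (f n) * (2 * (1 + n * R)) ^ ρ := by
    intro n
    have hM := messageCount_pos hR0 n
    have hM' : (1 : ℝ) ≤ messageCount R n := by exact_mod_cast hM
    have hlog : Real.log (messageCount R n) ≤ n * R := by
      rw [Real.log_le_iff_le_exp (by linarith)]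
      exact messageCount_le n
    have hlog0 := Real.log_nonneg hM'
    have hmom : 0 ≤ listMoment W ρ (f n) := zero_le_one.trans (one_le_listMoment W hρ hM (f n))
    have hnR : 0 ≤ n * R := by positivity
    calc q ^ n = Real.exp (n * R) ^ ρ * g ^ n := (exp_mul_rpow_mul_pow R ρ g n hg0).symm
      _ ≤ (2 * (messageCount R n : ℝ)) ^ ρ * g ^ n := by
          have := exp_div_two_le_messageCount hR0 n
          gcongr
          linarith
      _ = 2 ^ ρ * ((messageCount R n : ℝ) ^ ρ * g ^ n) := by
          rw [Real.mul_rpow zero_le_two (Nat.cast_nonneg _), mul_assoc]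
      _ ≤ 2 ^ ρ * (listMoment W ρ (f n) * (1 + n * R) ^ ρ) := by
          refine mul_le_mul_of_nonneg_left ((rpow_mul_pow_le_listMoment W hρ hg0.le hg hM
            (f n)).trans (mul_le_mul_of_nonneg_left ?_ hmom)) (by positivity)
          exact Real.rpow_le_rpow (by linarith) (by linarith) hρ.le
      _ = _ := by
          rw [Real.mul_rpow zero_le_two (by linarith)]
          ring
  -- Since `t ^ ρ = 1 / q`, the polynomial factor and the geometric decay fit under a single `ρ`-th
  -- power.
  set t := Real.exp (-(R + Real.log g / ρ)) with ht
  have ht1 : t < 1 := by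
    rw [ht, Real.exp_lt_one_iff, neg_lt_zero, ← mul_lt_mul_iff_left₀ hρ, add_mul,
      div_mul_cancel₀ _ hρ.ne']
    linarith
  have htq : t ^ ρ * q = 1 := by
    rw [ht, hq, ← Real.exp_mul, ← Real.exp_add, Real.exp_eq_one_iff]
    field_simp
    ring
  have hlim : Tendsto (fun n : ℕ => 2 * (1 + n * R) * t ^ n) atTop (𝓝 0) := by
    have h1 := (tendsto_pow_atTop_nhds_zero_of_lt_one (Real.exp_pos _).le ht1).const_mul 2
    have h2 := (tendsto_self_mul_const_pow_of_lt_one (Real.exp_pos _).le ht1).const_mul (2 * R)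
    have h3 := h1.add h2
    rw [mul_zero, mul_zero, add_zero] at h3
    exact h3.congr fun n => by ring
  have hlim' := hf.mul (hlim.rpow_const (p := ρ) (Or.inr hρ.le))
  rw [Real.zero_rpow hρ.ne', mul_zero] at hlim'
  refine absurd (ge_of_tendsto' hlim' fun n => ?_) (not_le.2 zero_lt_one)
  have ht0 : 0 ≤ t := (Real.exp_pos _).le
  have hnR : 0 ≤ n * R := by positivity
  calc (1 : ℝ) = (t ^ ρ) ^ n * q ^ n := by rw [← mul_pow, htq, one_pow]
    _ ≤ (t ^ ρ) ^ n * (listMoment W ρ (f n) * (2 * (1 + n * R)) ^ ρ) :=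
        mul_le_mul_of_nonneg_left (hbound n) (by positivity)
    _ = _ := by
        rw [Real.mul_rpow (x := 2 * (1 + n * R)) (by positivity) (by positivity),
          Real.rpow_pow_comm ht0]
        ring

end CutoffRate

/-- The first conjunct says that the supremum defining the cutoff rate is a genuine least upper
bound; the second that it equals the maximum of `E₀(ρ, P) / ρ` over all PMFs `P`, attained. -/
theorem theorem2 {X Y : Type*} [Fintype X] [Nonempty X] [Fintype Y] (W : DMC X Y)
    (ρ : ℝ) (hρ : 0 < ρ) :
    IsLUB (feedbackCutoffRates W ρ) (feedbackCutoffRate W ρ) ∧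
      IsGreatest ((fun P : X → ℝ => gallagerE0 W ρ P / ρ) '' stdSimplex ℝ X)
        (feedbackCutoffRate W ρ) := by
  obtain ⟨P, hP, hmin⟩ := exists_forall_gallagerSum_le W hρ
  have hpos := gallagerSum_pos W (ρ := ρ) hP
  have hnonneg : 0 ≤ gallagerE0 W ρ P / ρ := by
    rw [gallagerE0_eq_neg_log]
    exact div_nonneg (neg_nonneg.2 (Real.log_nonpos hpos.le (gallagerSum_le_one W hρ hP))) hρ.le
  have hlub : IsLUB (feedbackCutoffRates W ρ) (gallagerE0 W ρ P / ρ) := by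
    refine ⟨fun R hR => le_of_mem_feedbackCutoffRates W hρ hpos hmin hR,
      fun b hb => ?_⟩
    refine le_of_forall_lt fun R hR => ?_
    obtain ⟨R', hR', hR''⟩ := exists_between hR
    rcases le_or_gt 0 R' with h0 | h0
    · exact hR'.trans_le (hb (mem_feedbackCutoffRates_of_lt W hρ hP h0 hR''))
    -- A negative `R'` is no admissible rate, but rate zero always is, so the upper bound `b` is
    -- nonnegative.
    · exact (hR'.trans h0).trans_le (hb (zero_mem_feedbackCutoffRates W))
  have heq : feedbackCutoffRate W ρ = gallagerE0 W ρ P / ρ :=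
    hlub.csSup_eq ⟨0, zero_mem_feedbackCutoffRates W⟩
  rw [heq]
  refine ⟨hlub, ⟨P, hP, rfl⟩, ?_⟩
  rintro _ ⟨Q, hQ, rfl⟩
  refine div_le_div_of_nonneg_right ?_ hρ.le
  rw [gallagerE0_eq_neg_log, gallagerE0_eq_neg_log]
  exact neg_le_neg (Real.log_le_log hpos (hmin Q hQ))
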